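/- There is a universal constant $C>0$ such that the following holds. Let $n,r,s,\ell$ be positive integers with $r+s+\ell\le n$, let $q\ge 0$ be an integer, and let $S_1\subseteq\dots\subseteq S_{\ell+1}\subseteq\mathbb Z_2^n$ be subspaces with $\dim S_j=r+j-1$ for every $j$. Let $\mathcal S_s$ be the distribution of $(T_1,\dots,T_{\ell+1})$ obtained by choosing $(v_1,\dots,v_s)$ uniformly among all $s$-tuples of linearly independent vectors of $\mathbb Z_2^n$ with $\operatorname{span}\{v_1,\dots,v_s\}\cap S_{\ell+1}=\{0\}$, and setting $T_j:=\operatorname{span}\{S_j,v_1,\dots,v_s\}$ for all $j$. For a subspace $S'\subseteq\mathbb Z_2^n$, let $\mathcal O_{S'}$ be its membership oracle: on input $x$ it outputs $1$ if $x\in S'$ and $0$ otherwise. One quantum query to a tuple of oracles $(\mathcal O_{S'_1},\dots,\mathcal O_{S'_{\ell+1}})$ is the unitary $|j,x,b\rangle\mapsto|j,x,b\oplus\mathcal O_{S'_j}(x)\rangle$, which may be applied in superposition, including over the index $j$. Then for every oracle-aided quantum algorithm $\mathcal A$ with one-bit output (with a work register of arbitrary finite dimension and arbitrary unitaries between the queries)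 that makes at most $q$ quantum queries, $$\left|\Pr\left[\mathcal A^{\mathcal O_{S_1},\dots,\mathcal O_{S_{\ell+1}}}=1\right]-\Pr_{(T_1,\dots,T_{\ell+1})\leftarrow\mathcal S_s}\left[\mathcal A^{\mathcal O_{T_1},\dots,\mathcal O_{T_{\ell+1}}}=1\right]\right|\le C\cdot\frac{q\cdot\ell\cdot s}{\sqrt{2^{\,n-r-s-\ell}}}.$$ -/

import Mathlib

open scoped BigOperators

noncomputable section

/-- The vector space `ℤ₂ⁿ`. -/
abbrev BitSpace (n : ℕ) : Type := Fin n → ZMod 2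

/-- A tuple of `ℓ + 1` subspaces `(S₁, …, S_{ℓ+1})` of `ℤ₂ⁿ`, where `S_j` has index `j - 1`. -/
abbrev SubspaceTuple (n ℓ : ℕ) : Type := Fin (ℓ + 1) → Submodule (ZMod 2) (BitSpace n)

/-- Labels `(j, x, b, w)` of the computational basis of the machine: the index `j` of the oracle that
is queried, the query input `x`, the answer bit `b`, and a work register of dimension `d`. -/
abbrev BasisLabel (n ℓ d : ℕ) : Type := Fin (ℓ + 1) × BitSpace n × Bool × Fin d

/-- The Hilbert space of the machine, with its Euclidean norm. -/
abbrev StateSpace (n ℓ d : ℕ) : Type := EuclideanSpace ℂ (BasisLabel n ℓ d)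

open Classical in
/-- Action of the membership oracles on basis labels:
`(j, x, b, w) ↦ (j, x, b ⊕ [x ∈ S_j], w)`. -/
def oracleOnLabels {n ℓ : ℕ} (S : SubspaceTuple n ℓ) (d : ℕ) :
    Equiv.Perm (BasisLabel n ℓ d) :=
  Function.Involutive.toPerm
    (fun y => (y.1, y.2.1, xor y.2.2.1 (decide (y.2.1 ∈ S y.1)), y.2.2.2))
    (fun y => by simp)

/-- One quantum query to the membership oracles: the unitary that permutes the computational basis by
`|j, x, b, w⟩ ↦ |j, x, b ⊕ [x ∈ S_j], w⟩`. -/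
def oracleUnitary {n ℓ : ℕ} (S : SubspaceTuple n ℓ) (d : ℕ) :
    StateSpace n ℓ d ≃ₗᵢ[ℂ] StateSpace n ℓ d :=
  LinearIsometryEquiv.piLpCongrLeft 2 ℂ ℂ (oracleOnLabels S d)

/-- An oracle-aided quantum algorithm with one-bit output: a work register of arbitrary finite
dimension, a number of queries, an arbitrary initial pure state, an arbitrary unitary after each
query (`step i` follows query number `i`, counted from `0`; only those with `i < queries` are used),
and the set of outcomes of the final computational-basis measurement on which the output is `1`. -/
structure QueryAlgorithm (n ℓ : ℕ) where
  workDim : ℕ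
  queries : ℕ
  init : StateSpace n ℓ workDim
  norm_init : ‖init‖ = 1
  step : ℕ → StateSpace n ℓ workDim ≃ₗᵢ[ℂ] StateSpace n ℓ workDim
  accept : Finset (BasisLabel n ℓ workDim)

namespace QueryAlgorithm

/-- The state after the first `k` queries to the membership oracles of `S`, each followed by its
unitary. -/
def stateAfter {n ℓ : ℕ} (A : QueryAlgorithm n ℓ) (S : SubspaceTuple n ℓ) :
    ℕ → StateSpace n ℓ A.workDim
  | 0 => A.init
  | k + 1 => A.step k (oracleUnitary S A.workDim (A.stateAfter S k))

/-- The probability that `A` outputs `1` when run with the membership oracles of `S`. -/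
def acceptProb {n ℓ : ℕ} (A : QueryAlgorithm n ℓ) (S : SubspaceTuple n ℓ) : ℝ :=
  ∑ y ∈ A.accept, ‖A.stateAfter S A.queries y‖ ^ 2

end QueryAlgorithm

open Classical in
/-- The tuples `(v₁, …, v_s)` of linearly independent vectors with
`span {v₁, …, v_s} ∩ S_{ℓ+1} = {0}`. -/
def independentTuples {n ℓ : ℕ} (S : SubspaceTuple n ℓ) (s : ℕ) : Finset (Fin s → BitSpace n) :=
  Finset.univ.filter fun v =>
    LinearIndependent (ZMod 2) v ∧
      Submodule.span (ZMod 2) (Set.range v) ⊓ S (Fin.last ℓ) = ⊥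

/-- The superspaces `T_j = span {S_j, v₁, …, v_s}`. -/
def superspaces {n ℓ s : ℕ} (S : SubspaceTuple n ℓ) (v : Fin s → BitSpace n) :
    SubspaceTuple n ℓ :=
  fun j => S j ⊔ Submodule.span (ZMod 2) (Set.range v)

/-- The sample space of `(v₁, …, v_s)` is nonempty when the dimensions leave room, so the uniform
distribution on it exists. -/
theorem independentTuples_nonempty {n ℓ : ℕ} (S : SubspaceTuple n ℓ) (s : ℕ)
    (h : Module.finrank (ZMod 2) (S (Fin.last ℓ)) + s ≤ n) :
    (independentTuples S s).Nonempty := by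
  obtain ⟨Q, hQ⟩ := Submodule.exists_isCompl (S (Fin.last ℓ))
  have hf := Submodule.finrank_add_eq_of_isCompl hQ
  rw [Module.finrank_fin_fun] at hf
  have hs : s ≤ Module.finrank (ZMod 2) Q := by omega
  let b := Module.finBasis (ZMod 2) Q
  let v : Fin s → BitSpace n := fun i => (b (Fin.castLE hs i) : BitSpace n)
  have hli : LinearIndependent (ZMod 2) v :=
    (b.linearIndependent.comp _ (Fin.castLE_injective hs)).map' Q.subtype (Submodule.ker_subtype Q)
  have hle : Submodule.span (ZMod 2) (Set.range v) ≤ Q := by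
    rw [Submodule.span_le]
    rintro _ ⟨i, rfl⟩
    exact (b (Fin.castLE hs i)).2
  refine ⟨v, ?_⟩
  simp only [independentTuples, Finset.mem_filter, Finset.mem_univ, true_and]
  exact ⟨hli, (hQ.disjoint.symm.mono_left hle).eq_bot⟩

/-- The probability that `A` outputs `1` when `(v₁, …, v_s)` is drawn uniformly from the admissible
tuples and `A` is then run with the membership oracles of `T₁, …, T_{ℓ+1}`. -/
def superspaceAcceptProb {n ℓ : ℕ} (A : QueryAlgorithm n ℓ) (S : SubspaceTuple n ℓ) (s : ℕ) : ℝ :=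
  (∑ v ∈ independentTuples S s, A.acceptProb (superspaces S v)) / (independentTuples S s).card

end

/-! The oracles of `S` and `T` differ at `(j, x)` only when `x` lies in `T_j` but not in `S_j`, and
this is rare for each fixed `x`. If `x ∈ S_{ℓ+1}` it never happens. Otherwise symmetry applies:
automorphisms fixing `S_{ℓ+1}` pointwise permute the admissible tuples and act transitively on the
complement of `S_{ℓ+1}`, so all such `x` are equally likely to be covered, and `T_j` is small
(`card_tuplesCovering_mul_le`).

In the hybrid argument the errors are measured along the run with `S`, whose states do not depend on
the random tuple. The mean squared error of one query is therefore `O(2^{r+s+ℓ-n})`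
(`sum_norm_oracle_sub_sq_le`). Cauchy–Schwarz bounds the mean error, and errors add over the
queries. -/

section LinearAlgebra

/-- Over `ℤ₂`, two vectors outside a subspace `W` are separated from `W` by a common functional. -/
theorem exists_dual_eq_one_of_notMem {V : Type*} [AddCommGroup V] [Module (ZMod 2) V]
    (W : Submodule (ZMod 2) V) {x y : V} (hx : x ∉ W) (hy : y ∉ W) :
    ∃ f : V →ₗ[ZMod 2] ZMod 2, W ≤ LinearMap.ker f ∧ f x = 1 ∧ f y = 1 := by
  have one_of_ne : ∀ a : ZMod 2, a ≠ 0 → a = 1 := by decide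
  have zero_or : ∀ a : ZMod 2, a = 0 ∨ a = 1 := by decide
  obtain ⟨f, hfx, hfW⟩ := Submodule.exists_le_ker_of_notMem hx
  obtain ⟨g, hgy, hgW⟩ := Submodule.exists_le_ker_of_notMem hy
  have hfx := one_of_ne _ hfx
  have hgy := one_of_ne _ hgy
  -- If neither functional is `1` at both vectors, then `f y = g x = 0` and the sum works.
  rcases zero_or (f y) with hfy | hfy
  · rcases zero_or (g x) with hgx | hgx
    · refine ⟨f + g, fun w hw => ?_, by simp [hfx, hgx], by simp [hfy, hgy]⟩
      have h1 : f w = 0 := hfW hw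
      have h2 : g w = 0 := hgW hw
      simp [h1, h2]
    · exact ⟨g, hgW, hgx, hgy⟩
  · exact ⟨f, hfW, hfx, hfy⟩

/-- A linear automorphism that fixes `W` pointwise and maps `x` to `y`, for `x, y ∉ W`. -/
theorem exists_linearEquiv_fixing {V : Type*} [AddCommGroup V] [Module (ZMod 2) V]
    (W : Submodule (ZMod 2) V) {x y : V} (hx : x ∉ W) (hy : y ∉ W) :
    ∃ g : V ≃ₗ[ZMod 2] V, (∀ w ∈ W, g w = w) ∧ g x = y := by
  obtain ⟨f, hfW, hfx, hfy⟩ := exists_dual_eq_one_of_notMem W hx hy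
  -- This makes the transvection `v ↦ v + f v • (y - x)` invertible.
  have hfd : f (y - x) = 0 := by simp [hfx, hfy]
  refine ⟨LinearEquiv.transvection hfd, fun w hw => ?_, ?_⟩
  · have h : f w = 0 := hfW hw
    simp [LinearMap.transvection.apply, h]
  · simp [LinearMap.transvection.apply, hfx]

end LinearAlgebra

/-! ### Probability that a random superspace contains a fixed vector. -/

section Counting

variable {n ℓ s : ℕ}

theorem mem_independentTuples {S : SubspaceTuple n ℓ} {v : Fin s → BitSpace n} :
    v ∈ independentTuples S s ↔ LinearIndependent (ZMod 2) v ∧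
      Submodule.span (ZMod 2) (Set.range v) ⊓ S (Fin.last ℓ) = ⊥ := by
  simp [independentTuples]

theorem span_range_comp (g : BitSpace n ≃ₗ[ZMod 2] BitSpace n) (v : Fin s → BitSpace n) :
    Submodule.span (ZMod 2) (Set.range (g ∘ v)) =
      (Submodule.span (ZMod 2) (Set.range v)).map (g : BitSpace n →ₗ[ZMod 2] BitSpace n) := by
  rw [Submodule.map_span, Set.range_comp]
  rfl

theorem map_eq_self_of_fixing (g : BitSpace n ≃ₗ[ZMod 2] BitSpace n)
    {U : Submodule (ZMod 2) (BitSpace n)} (hg : ∀ w ∈ U, g w = w) :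
    U.map (g : BitSpace n →ₗ[ZMod 2] BitSpace n) = U := by
  ext x
  simp only [Submodule.mem_map, LinearEquiv.coe_coe]
  constructor
  · rintro ⟨w, hw, rfl⟩
    rwa [hg w hw]
  · exact fun hx => ⟨x, hx, hg x hx⟩

theorem comp_mem_independentTuples {S : SubspaceTuple n ℓ} (g : BitSpace n ≃ₗ[ZMod 2] BitSpace n)
    (hg : ∀ w ∈ S (Fin.last ℓ), g w = w) {v : Fin s → BitSpace n}
    (hv : v ∈ independentTuples S s) : g ∘ v ∈ independentTuples S s := by
  rw [mem_independentTuples] at hv ⊢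
  refine ⟨hv.1.map' (g : BitSpace n →ₗ[ZMod 2] BitSpace n) g.ker, ?_⟩
  nth_rewrite 1 [← map_eq_self_of_fixing g hg]
  rw [span_range_comp, ← Submodule.map_inf _ g.injective, hv.2, Submodule.map_bot]

theorem superspaces_comp {S : SubspaceTuple n ℓ} (hS : Monotone S)
    (g : BitSpace n ≃ₗ[ZMod 2] BitSpace n) (hg : ∀ w ∈ S (Fin.last ℓ), g w = w)
    (v : Fin s → BitSpace n) (j : Fin (ℓ + 1)) :
    superspaces S (g ∘ v) j =
      (superspaces S v j).map (g : BitSpace n →ₗ[ZMod 2] BitSpace n) := by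
  have h := map_eq_self_of_fixing g fun w (hw : w ∈ S j) => hg w (hS (Fin.le_last j) hw)
  rw [superspaces, superspaces, Submodule.map_sup, h, span_range_comp]

open Classical in
/-- The admissible tuples whose superspace number `j` contains `x`. -/
noncomputable def tuplesCovering (S : SubspaceTuple n ℓ) (s : ℕ) (j : Fin (ℓ + 1)) (x : BitSpace n) :
    Finset (Fin s → BitSpace n) :=
  (independentTuples S s).filter fun v => x ∈ superspaces S v j

theorem mem_tuplesCovering {S : SubspaceTuple n ℓ} {j : Fin (ℓ + 1)} {x : BitSpace n}
    {v : Fin s → BitSpace n} :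
    v ∈ tuplesCovering S s j x ↔ v ∈ independentTuples S s ∧ x ∈ superspaces S v j := by
  simp [tuplesCovering]

/-- An automorphism taking `x` to `y` and fixing `S_{ℓ+1}` carries tuples covering `x` injectively
to tuples covering `y`. -/
theorem card_tuplesCovering_le {S : SubspaceTuple n ℓ} (hS : Monotone S) (j : Fin (ℓ + 1))
    {x y : BitSpace n} (hx : x ∉ S (Fin.last ℓ)) (hy : y ∉ S (Fin.last ℓ)) :
    (tuplesCovering S s j x).card ≤ (tuplesCovering S s j y).card := by
  obtain ⟨g, hg, hgx⟩ := exists_linearEquiv_fixing _ hx hy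
  refine Finset.card_le_card_of_injOn (fun v => g ∘ v) (fun v hv => ?_)
    (g.injective.comp_left.injOn)
  have hv := mem_tuplesCovering.1 (Finset.mem_coe.1 hv)
  refine Finset.mem_coe.2 (mem_tuplesCovering.2 ⟨comp_mem_independentTuples g hg hv.1, ?_⟩)
  rw [superspaces_comp hS g hg, ← hgx]
  exact Submodule.mem_map_of_mem hv.2

open Classical in
theorem card_filter_mem_submodule (U : Submodule (ZMod 2) (BitSpace n)) :
    (Finset.univ.filter fun x => x ∈ U).card = 2 ^ Module.finrank (ZMod 2) U := by
  rw [← Fintype.card_subtype, ← Nat.card_eq_fintype_card]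
  have h := Module.natCard_eq_pow_finrank (K := ZMod 2) (V := U)
  rw [Nat.card_zmod] at h
  exact h

theorem finrank_superspaces_le (S : SubspaceTuple n ℓ) (v : Fin s → BitSpace n)
    (j : Fin (ℓ + 1)) :
    Module.finrank (ZMod 2) (superspaces S v j) ≤ Module.finrank (ZMod 2) (S j) + s := by
  refine (Submodule.finrank_add_le_finrank_add_finrank _ _).trans ?_
  gcongr
  simpa [Set.finrank] using finrank_range_le_card (R := ZMod 2) v

/-- A vector of `S_{ℓ+1}` lies in `T_j` only if it lies in `S_j`. -/
theorem mem_of_mem_superspaces {S : SubspaceTuple n ℓ} (hS : Monotone S) {j : Fin (ℓ + 1)}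
    {x : BitSpace n} (hx : x ∈ S (Fin.last ℓ)) {v : Fin s → BitSpace n}
    (hv : v ∈ independentTuples S s) (hxv : x ∈ superspaces S v j) : x ∈ S j := by
  obtain ⟨a, ha, b, hb, rfl⟩ := Submodule.mem_sup.1 hxv
  have hbS : b ∈ S (Fin.last ℓ) :=
    (Submodule.add_mem_iff_right _ (hS (Fin.le_last j) ha)).1 hx
  have hb0 : b ∈ (⊥ : Submodule (ZMod 2) (BitSpace n)) :=
    (mem_independentTuples.1 hv).2 ▸ Submodule.mem_inf.2 ⟨hb, hbS⟩
  rw [Submodule.mem_bot] at hb0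
  simpa [hb0] using ha

open Classical in
/-- A fixed vector outside `S_j` lies in `T_j` with probability at most `2^{r+s+ℓ} / 2^{n-1}`. -/
theorem card_tuplesCovering_mul_le {S : SubspaceTuple n ℓ} (hS : Monotone S) {r : ℕ}
    (hr : Module.finrank (ZMod 2) (S (Fin.last ℓ)) = r) (hrn : r < n)
    (j : Fin (ℓ + 1)) {x : BitSpace n} (hx : x ∉ S j) :
    (tuplesCovering S s j x).card * 2 ^ n ≤ 2 * ((independentTuples S s).card * 2 ^ (r + s)) := by
  by_cases hxl : x ∈ S (Fin.last ℓ)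
  · have : tuplesCovering S s j x = ∅ := by
      refine Finset.eq_empty_of_forall_notMem fun v hv => hx ?_
      exact mem_of_mem_superspaces hS hxl (mem_tuplesCovering.1 hv).1 (mem_tuplesCovering.1 hv).2
    simp [this]
  set O : Finset (BitSpace n) := Finset.univ.filter fun y => ¬ y ∈ S (Fin.last ℓ) with hO
  have hcard : 2 ^ r + O.card = 2 ^ n := by
    have h := Finset.card_filter_add_card_filter_not (s := (Finset.univ : Finset (BitSpace n)))
      (fun y => y ∈ S (Fin.last ℓ))
    rw [card_filter_mem_submodule, hr] at h
    simpa [ZMod.card] using h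
  -- A proper subspace fills at most half of the space; this costs the factor 2.
  have hpow : 2 * 2 ^ r ≤ 2 ^ n := by
    rw [← pow_succ']
    exact Nat.pow_le_pow_right (by norm_num) hrn
  -- Double counting of the pairs `(y, v)` with `y ∈ O` covered by `v`.
  have hsum : O.card * (tuplesCovering S s j x).card ≤
      (independentTuples S s).card * 2 ^ (r + s) := by
    calc O.card * (tuplesCovering S s j x).card
        ≤ ∑ y ∈ O, (tuplesCovering S s j y).card := by
          rw [← smul_eq_mul]
          exact Finset.card_nsmul_le_sum _ _ _ fun y hy =>
            card_tuplesCovering_le hS j hxl (Finset.mem_filter.1 hy).2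
      _ = ∑ v ∈ independentTuples S s, (O.filter fun y => y ∈ superspaces S v j).card := by
          exact Finset.sum_card_bipartiteAbove_eq_sum_card_bipartiteBelow
            (fun y v => y ∈ superspaces S v j)
      _ ≤ ∑ v ∈ independentTuples S s, 2 ^ (r + s) := by
          refine Finset.sum_le_sum fun v _ => ?_
          calc (O.filter fun y => y ∈ superspaces S v j).card
              ≤ (Finset.univ.filter fun y => y ∈ superspaces S v j).card :=
                Finset.card_le_card (Finset.filter_subset_filter _ (Finset.subset_univ _))
            _ = 2 ^ Module.finrank (ZMod 2) (superspaces S v j) := card_filter_mem_submodule _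
            _ ≤ 2 ^ (r + s) := by
                refine Nat.pow_le_pow_right (by norm_num) ((finrank_superspaces_le S v j).trans ?_)
                rw [← hr]
                gcongr
                exact Submodule.finrank_mono (hS (Fin.le_last j))
      _ = (independentTuples S s).card * 2 ^ (r + s) := by simp
  have h2 : 2 ^ n ≤ 2 * O.card := by omega
  calc (tuplesCovering S s j x).card * 2 ^ n
      ≤ (tuplesCovering S s j x).card * (2 * O.card) := Nat.mul_le_mul_left _ h2
    _ = 2 * (O.card * (tuplesCovering S s j x).card) := by ring
    _ ≤ _ := Nat.mul_le_mul_left _ hsum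

end Counting

/-! ### Hybrid argument for quantum queries. -/

section Hybrid

variable {n ℓ : ℕ}

open Classical in
/-- The basis labels on which the oracles of `S` and `T` differ. -/
noncomputable def disagreement (S T : SubspaceTuple n ℓ) (d : ℕ) : Finset (BasisLabel n ℓ d) :=
  Finset.univ.filter fun y => ¬ (y.2.1 ∈ S y.1 ↔ y.2.1 ∈ T y.1)

theorem mem_disagreement {S T : SubspaceTuple n ℓ} {d : ℕ} {y : BasisLabel n ℓ d} :
    y ∈ disagreement S T d ↔ ¬ (y.2.1 ∈ S y.1 ↔ y.2.1 ∈ T y.1) := by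
  simp [disagreement]

theorem oracleUnitary_apply (S : SubspaceTuple n ℓ) {d : ℕ} (ψ : StateSpace n ℓ d)
    (y : BasisLabel n ℓ d) : oracleUnitary S d ψ y = ψ (oracleOnLabels S d y) := rfl

/-- A query changes only the answer bit, while disagreement depends only on `(j, x)`. -/
theorem sum_disagreement_comp (S T U : SubspaceTuple n ℓ) {d : ℕ} (f : BasisLabel n ℓ d → ℝ) :
    ∑ y ∈ disagreement S T d, f (oracleOnLabels U d y) = ∑ y ∈ disagreement S T d, f y := by
  refine Finset.sum_equiv (oracleOnLabels U d) (fun y => ?_) (fun y _ => rfl)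
  rw [mem_disagreement, mem_disagreement]
  rfl

open Classical in
theorem norm_oracle_sub_sq_le (S T : SubspaceTuple n ℓ) {d : ℕ} (ψ : StateSpace n ℓ d) :
    ‖oracleUnitary T d ψ - oracleUnitary S d ψ‖ ^ 2 ≤
      4 * ∑ y ∈ disagreement S T d, ‖ψ y‖ ^ 2 := by
  rw [EuclideanSpace.norm_sq_eq]
  have hzero : ∀ y, y ∉ disagreement S T d →
      ‖(oracleUnitary T d ψ - oracleUnitary S d ψ) y‖ ^ 2 = 0 := by
    intro y hy
    rw [mem_disagreement, not_not] at hy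
    have h : oracleOnLabels T d y = oracleOnLabels S d y := by
      change (y.1, y.2.1, xor y.2.2.1 (decide (y.2.1 ∈ T y.1)), y.2.2.2) =
        (y.1, y.2.1, xor y.2.2.1 (decide (y.2.1 ∈ S y.1)), y.2.2.2)
      rw [decide_eq_decide.2 hy]
    rw [PiLp.sub_apply, oracleUnitary_apply, oracleUnitary_apply, h]
    simp
  rw [← Finset.sum_subset (Finset.subset_univ (disagreement S T d)) fun y _ hy => hzero y hy]
  calc ∑ y ∈ disagreement S T d, ‖(oracleUnitary T d ψ - oracleUnitary S d ψ) y‖ ^ 2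
      ≤ ∑ y ∈ disagreement S T d, (2 * ‖ψ (oracleOnLabels T d y)‖ ^ 2 +
          2 * ‖ψ (oracleOnLabels S d y)‖ ^ 2) := by
        refine Finset.sum_le_sum fun y _ => ?_
        rw [PiLp.sub_apply, oracleUnitary_apply, oracleUnitary_apply]
        have h := norm_sub_le (ψ (oracleOnLabels T d y)) (ψ (oracleOnLabels S d y))
        have h0 := norm_nonneg (ψ (oracleOnLabels T d y) - ψ (oracleOnLabels S d y))
        nlinarith [sq_nonneg (‖ψ (oracleOnLabels T d y)‖ - ‖ψ (oracleOnLabels S d y)‖)]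
    _ = 4 * ∑ y ∈ disagreement S T d, ‖ψ y‖ ^ 2 := by
        rw [Finset.sum_add_distrib, ← Finset.mul_sum, ← Finset.mul_sum,
          sum_disagreement_comp S T T fun y => ‖ψ y‖ ^ 2,
          sum_disagreement_comp S T S fun y => ‖ψ y‖ ^ 2]
        ring

namespace QueryAlgorithm

theorem norm_stateAfter (A : QueryAlgorithm n ℓ) (S : SubspaceTuple n ℓ) (k : ℕ) :
    ‖A.stateAfter S k‖ = 1 := by
  induction k with
  | zero => exact A.norm_init
  | succ k ih => rw [stateAfter, LinearIsometryEquiv.norm_map, LinearIsometryEquiv.norm_map, ih]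

/-- Unitaries preserve the accumulated distance, so each round adds only the error of one query on
the state of the run with `S`. -/
theorem norm_stateAfter_sub_le (A : QueryAlgorithm n ℓ) (S T : SubspaceTuple n ℓ) (k : ℕ) :
    ‖A.stateAfter T k - A.stateAfter S k‖ ≤
      ∑ i ∈ Finset.range k, ‖oracleUnitary T A.workDim (A.stateAfter S i) -
        oracleUnitary S A.workDim (A.stateAfter S i)‖ := by
  induction k with
  | zero => simp [stateAfter]
  | succ k ih =>
    rw [Finset.sum_range_succ, stateAfter, stateAfter, ← map_sub, LinearIsometryEquiv.norm_map]
    refine (norm_sub_le_norm_sub_add_norm_sub _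
      (oracleUnitary T A.workDim (A.stateAfter S k)) _).trans ?_
    rw [← map_sub, LinearIsometryEquiv.norm_map]
    gcongr

/-- Factor the difference of squares at each label; Cauchy–Schwarz against each of the two unit
vectors gives the 2. -/
theorem abs_acceptProb_sub_le (A : QueryAlgorithm n ℓ) (S T : SubspaceTuple n ℓ) :
    |A.acceptProb S - A.acceptProb T| ≤
      2 * ‖A.stateAfter T A.queries - A.stateAfter S A.queries‖ := by
  set a := A.stateAfter S A.queries with ha
  set b := A.stateAfter T A.queries with hb
  have ha1 : ‖a‖ = 1 := A.norm_stateAfter S _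
  have hb1 : ‖b‖ = 1 := A.norm_stateAfter T _
  have hle : ∀ c : StateSpace n ℓ A.workDim, ∑ y ∈ A.accept, ‖c y‖ ^ 2 ≤ ‖c‖ ^ 2 := fun c => by
    rw [EuclideanSpace.norm_sq_eq]
    exact Finset.sum_le_sum_of_subset_of_nonneg (Finset.subset_univ _) fun _ _ _ => by positivity
  have hsum : |A.acceptProb S - A.acceptProb T| ≤
      ∑ y ∈ A.accept, ‖(b - a) y‖ * (‖a y‖ + ‖b y‖) := by
    rw [acceptProb, acceptProb, ← Finset.sum_sub_distrib]
    refine (Finset.abs_sum_le_sum_abs _ _).trans (Finset.sum_le_sum fun y _ => ?_)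
    rw [← ha, ← hb, sq_sub_sq, abs_mul, mul_comm, PiLp.sub_apply, norm_sub_rev,
      abs_of_nonneg (by positivity : 0 ≤ ‖a y‖ + ‖b y‖)]
    gcongr
    exact abs_norm_sub_norm_le _ _
  have hcs : ∀ c : StateSpace n ℓ A.workDim, ‖c‖ = 1 →
      ∑ y ∈ A.accept, ‖(b - a) y‖ * ‖c y‖ ≤ ‖b - a‖ := fun c hc => by
    refine le_of_sq_le_sq ?_ (norm_nonneg _)
    refine (Finset.sum_mul_sq_le_sq_mul_sq _ _ _).trans ?_
    calc _ ≤ ‖b - a‖ ^ 2 * ‖c‖ ^ 2 :=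
          mul_le_mul (hle _) (hle _) (Finset.sum_nonneg fun _ _ => by positivity) (by positivity)
      _ = ‖b - a‖ ^ 2 := by rw [hc]; ring
  refine hsum.trans ?_
  simp only [mul_add, Finset.sum_add_distrib]
  linarith [hcs a ha1, hcs b hb1]

end QueryAlgorithm

/-- The squared perturbation of a query, summed over the admissible tuples. -/
theorem sum_norm_oracle_sub_sq_le {s r : ℕ} {S : SubspaceTuple n ℓ} (hS : Monotone S)
    (hr : Module.finrank (ZMod 2) (S (Fin.last ℓ)) = r) (hrn : r < n)
    {d : ℕ} (ψ : StateSpace n ℓ d) (hψ : ‖ψ‖ = 1) :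
    (∑ v ∈ independentTuples S s,
      ‖oracleUnitary (superspaces S v) d ψ - oracleUnitary S d ψ‖ ^ 2) * 2 ^ n ≤
      8 * ((independentTuples S s).card * 2 ^ (r + s)) := by
  classical
  have hdis : ∀ v : Fin s → BitSpace n, ∀ y : BasisLabel n ℓ d,
      y ∈ disagreement S (superspaces S v) d ↔
        y.2.1 ∉ S y.1 ∧ y.2.1 ∈ superspaces S v y.1 := by
    intro v y
    have h : y.2.1 ∈ S y.1 → y.2.1 ∈ superspaces S v y.1 := fun h =>
      (le_sup_left : S y.1 ≤ superspaces S v y.1) h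
    rw [mem_disagreement]
    tauto
  -- Since `ψ` is independent of `v`, the weight of a label counts once for each tuple covering it.
  have hswap : ∑ v ∈ independentTuples S s, ∑ y ∈ disagreement S (superspaces S v) d, ‖ψ y‖ ^ 2 =
      ∑ y ∈ Finset.univ.filter (fun y : BasisLabel n ℓ d => y.2.1 ∉ S y.1),
        ((tuplesCovering S s y.1 y.2.1).card : ℝ) * ‖ψ y‖ ^ 2 := by
    rw [Finset.sum_comm' (t' := Finset.univ.filter (fun y : BasisLabel n ℓ d => y.2.1 ∉ S y.1))
      (s' := fun y => tuplesCovering S s y.1 y.2.1)]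
    · simp
    · intro v y
      rw [hdis, mem_tuplesCovering, Finset.mem_filter]
      simp only [Finset.mem_univ, true_and]
      tauto
  calc _ ≤ (∑ v ∈ independentTuples S s,
        4 * ∑ y ∈ disagreement S (superspaces S v) d, ‖ψ y‖ ^ 2) * 2 ^ n := by
        gcongr
        exact norm_oracle_sub_sq_le _ _ _
    _ = 4 * ∑ y ∈ Finset.univ.filter (fun y : BasisLabel n ℓ d => y.2.1 ∉ S y.1),
        ((tuplesCovering S s y.1 y.2.1).card * 2 ^ n : ℝ) * ‖ψ y‖ ^ 2 := by
        rw [← Finset.mul_sum, hswap, mul_assoc, Finset.sum_mul]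
        congr 1
        exact Finset.sum_congr rfl fun _ _ => by ring
    _ ≤ 4 * ∑ y ∈ Finset.univ.filter (fun y : BasisLabel n ℓ d => y.2.1 ∉ S y.1),
        (2 * ((independentTuples S s).card * 2 ^ (r + s)) : ℝ) * ‖ψ y‖ ^ 2 := by
        refine mul_le_mul_of_nonneg_left (Finset.sum_le_sum fun y hy => ?_) (by norm_num)
        refine mul_le_mul_of_nonneg_right ?_ (sq_nonneg _)
        exact_mod_cast card_tuplesCovering_mul_le hS hr hrn y.1 (Finset.mem_filter.1 hy).2
    _ ≤ 4 * ∑ y, (2 * ((independentTuples S s).card * 2 ^ (r + s)) : ℝ) * ‖ψ y‖ ^ 2 := by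
        gcongr
        exact Finset.filter_subset _ _
    _ = 8 * ((independentTuples S s).card * 2 ^ (r + s)) := by
        rw [← Finset.mul_sum, ← EuclideanSpace.norm_sq_eq, hψ]
        ring

/-- The average perturbation of a query. -/
theorem sum_norm_oracle_sub_le {s r : ℕ} {S : SubspaceTuple n ℓ} (hS : Monotone S)
    (hr : Module.finrank (ZMod 2) (S (Fin.last ℓ)) = r) (hrn : r < n) (hrs : r + s ≤ n)
    {d : ℕ} (ψ : StateSpace n ℓ d) (hψ : ‖ψ‖ = 1) :
    ∑ v ∈ independentTuples S s,
      ‖oracleUnitary (superspaces S v) d ψ - oracleUnitary S d ψ‖ ≤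
      (independentTuples S s).card * (3 / Real.sqrt (2 ^ (n - (r + s)))) := by
  have h := sum_norm_oracle_sub_sq_le (s := s) hS hr hrn ψ hψ
  set N : ℝ := ((independentTuples S s).card : ℝ)
  have hN : 0 ≤ N := Nat.cast_nonneg _
  have hpow : (2 : ℝ) ^ n = 2 ^ (r + s) * 2 ^ (n - (r + s)) := by
    rw [← pow_add, Nat.add_sub_cancel' hrs]
  rw [hpow] at h
  set m : ℝ := 2 ^ (n - (r + s))
  have hm : 0 < m := by positivity
  have h' : ∑ v ∈ independentTuples S s,
      ‖oracleUnitary (superspaces S v) d ψ - oracleUnitary S d ψ‖ ^ 2 ≤ 8 * N / m := by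
    rw [le_div_iff₀ hm]
    have hp : (0 : ℝ) < 2 ^ (r + s) := by positivity
    refine le_of_mul_le_mul_right ?_ hp
    linarith
  refine le_of_sq_le_sq ?_ (by positivity)
  calc _ ≤ N * ∑ v ∈ independentTuples S s,
        ‖oracleUnitary (superspaces S v) d ψ - oracleUnitary S d ψ‖ ^ 2 := sq_sum_le_card_mul_sum_sq
    _ ≤ N * (8 * N / m) := by gcongr
    _ = 8 * (N ^ 2 / m) := by ring
    -- Rounding 8 up to a perfect square yields the constant 3.
    _ ≤ 9 * (N ^ 2 / m) := by gcongr; norm_num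
    _ = (N * (3 / Real.sqrt m)) ^ 2 := by
        rw [mul_pow, div_pow, Real.sq_sqrt hm.le]
        ring

end Hybrid

theorem mainTheorem2 :
    ∃ C : ℝ, 0 < C ∧
      ∀ (n r s ℓ q : ℕ), 0 < n → 0 < r → 0 < s → 0 < ℓ → r + s + ℓ ≤ n →
      ∀ S : SubspaceTuple n ℓ, Monotone S →
        (∀ j : Fin (ℓ + 1), Module.finrank (ZMod 2) (S j) = r + (j : ℕ)) →
      ∀ A : QueryAlgorithm n ℓ, A.queries ≤ q →
        |A.acceptProb S - superspaceAcceptProb A S s| ≤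
          C * (((q : ℝ) * (ℓ : ℝ) * (s : ℝ)) / Real.sqrt ((2 : ℝ) ^ (n - r - s - ℓ))) := by
  -- 6 is 2 from the measurement times 3 from the mean error of a query.
  refine ⟨6, by norm_num, fun n r s ℓ q _ _ hs hℓ hn S hS hdim A hq => ?_⟩
  -- The `r` of the earlier lemmas is the dimension of the largest subspace, here `r + ℓ`.
  have hr : Module.finrank (ZMod 2) (S (Fin.last ℓ)) = r + ℓ := by simpa using hdim (Fin.last ℓ)
  have hNpos : (0 : ℝ) < (independentTuples S s).card := by
    exact_mod_cast (independentTuples_nonempty S s (by omega)).card_pos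
  have hexp : n - r - s - ℓ = n - (r + ℓ + s) := by omega
  rw [hexp]
  set ε : ℝ := 3 / Real.sqrt (2 ^ (n - (r + ℓ + s))) with hε
  have hε0 : 0 ≤ ε := by positivity
  have hmean : |A.acceptProb S - superspaceAcceptProb A S s| ≤ 2 * (A.queries * ε) := by
    have hrepr : A.acceptProb S - superspaceAcceptProb A S s =
        (∑ v ∈ independentTuples S s, (A.acceptProb S - A.acceptProb (superspaces S v))) /
          (independentTuples S s).card := by
      rw [superspaceAcceptProb, Finset.sum_sub_distrib, Finset.sum_const, nsmul_eq_mul, sub_div,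
        mul_div_cancel_left₀ _ hNpos.ne']
    rw [hrepr, abs_div, abs_of_pos hNpos, div_le_iff₀ hNpos]
    calc _ ≤ ∑ v ∈ independentTuples S s,
          |A.acceptProb S - A.acceptProb (superspaces S v)| := Finset.abs_sum_le_sum_abs _ _
      _ ≤ ∑ v ∈ independentTuples S s, 2 * ∑ i ∈ Finset.range A.queries,
          ‖oracleUnitary (superspaces S v) A.workDim (A.stateAfter S i) -
            oracleUnitary S A.workDim (A.stateAfter S i)‖ := by
          refine Finset.sum_le_sum fun v _ => (A.abs_acceptProb_sub_le S _).trans ?_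
          gcongr
          exact A.norm_stateAfter_sub_le S _ _
      _ = 2 * ∑ i ∈ Finset.range A.queries, ∑ v ∈ independentTuples S s,
          ‖oracleUnitary (superspaces S v) A.workDim (A.stateAfter S i) -
            oracleUnitary S A.workDim (A.stateAfter S i)‖ := by
          rw [← Finset.mul_sum, Finset.sum_comm]
      _ ≤ 2 * ∑ i ∈ Finset.range A.queries, (independentTuples S s).card * ε := by
          gcongr with i
          exact sum_norm_oracle_sub_le hS hr (by omega) (by omega) _ (A.norm_stateAfter S i)
      _ = 2 * (A.queries * ε) * (independentTuples S s).card := by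
          rw [Finset.sum_const, Finset.card_range, nsmul_eq_mul]
          ring
  -- The bound so far has no factor `ℓ * s`; it is inserted because it is at least 1.
  have hℓs : (1 : ℝ) ≤ ℓ * s := by exact_mod_cast Nat.mul_pos hℓ hs
  calc _ ≤ 2 * (A.queries * ε) := hmean
    _ ≤ 2 * (q * ε) := by gcongr
    _ ≤ 2 * (q * ε) * (ℓ * s) := le_mul_of_one_le_right (by positivity) hℓs
    _ = _ := by rw [hε]; ring
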